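/- Let $\mathcal X$ and $\mathcal Y$ be compact metric spaces, $\Theta$ a metric space and $\mathcal Z$ a measurable space. Let $\zeta$ be a probability measure on $\mathcal Z$, $\nu$ a Borel probability measure on $\mathcal Y$, $c:\mathcal X\times\mathcal Y\to\mathbf R$ a continuous cost, $\lambda>0$, and let $g:\Theta\times\mathcal Z\to\mathcal X$, $g_\theta=g(\theta,\cdot)$, be such that $g_\theta$ is measurable for every $\theta$ and $\theta\mapsto g_\theta(z)$ is continuous for every $z$. (These conditions on $g$ hold in particular when $\mathcal X$, $\mathcal Z$, $\Theta$ are subsets of Euclidean spaces, $\mathcal Z$ carries its Borel $\sigma$-algebra, and for every $\theta$ there are a function $L(\theta,\cdot)\ge 0$ with $\mathbf E_{Z\sim\zeta}[L(\theta,Z)]<\infty$ and a neighborhood $\Omega$ of $\theta$ such that $\|g(\theta,z)-g(\theta',z')\|\le L(\theta,z)\|(\theta,z)-(\theta',z')\|$ for all $\theta'\in\Omega$ and $z,z'\in\mathcal Z$.) For $\psi\in L^\infty(\nu)$ put $$\psi^{c,\lambda}(x)=-\lambda\log\left(\int_{\mathcal Y}\exp\left(\frac{\psi(y)-c(x,y)}{\lambda}\right)d\nu(y)\right),\qquad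 F_c^\lambda(\theta,\psi)=\mathbf E_{Z\sim\zeta}\left[\psi^{c,\lambda}(g_\theta(Z))\right]+\mathbf E_{Y\sim\nu}[\psi(Y)].$$ Then there exists a continuous selection of Kantorovich potentials, that is, a function $\psi_*:\Theta\to\mathscr C(\mathcal Y)$ which is continuous for the uniform norm on $\mathscr C(\mathcal Y)$ and such that, for every $\theta\in\Theta$, $\psi_*(\theta)\in\operatorname{argmax}_{\psi\in L^\infty(\nu)}F_c^\lambda(\theta,\psi)$. Moreover, for any prescribed point $y_0\in\mathcal Y$, $\psi_*$ can be chosen so that $\psi_*(\theta)(y_0)=0$ for all $\theta\in\Theta$. -/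

import Mathlib

open MeasureTheory

noncomputable section

/-- The regularized `c,λ`-transform (soft `c`-transform) of `ψ : Y → ℝ` with respect to `ν`:
`ψ^{c,λ}(x) = -λ log ∫ exp((ψ(y) - c(x,y)) / λ) dν(y)`. -/
def softCTransform {X Y : Type*} [MeasurableSpace Y] (c : X × Y → ℝ) (lam : ℝ) (ν : Measure Y)
    (ψ : Y → ℝ) (x : X) : ℝ :=
  -lam * Real.log (∫ y, Real.exp ((ψ y - c (x, y)) / lam) ∂ν)

/-- The entropic semi-dual functional
`F_c^λ(θ, ψ) = E_{Z ∼ ζ}[ψ^{c,λ}(g_θ(Z))] + E_{Y ∼ ν}[ψ(Y)]`. -/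
def semiDual {Θ Z X Y : Type*} [MeasurableSpace Z] [MeasurableSpace Y]
    (c : X × Y → ℝ) (lam : ℝ) (ζ : Measure Z) (ν : Measure Y) (g : Θ → Z → X)
    (θ : Θ) (ψ : Y → ℝ) : ℝ :=
  (∫ z, softCTransform c lam ν ψ (g θ z) ∂ζ) + ∫ y, ψ y ∂ν

/-- The Kantorovich potentials at the parameter `θ`: the set of maximizers of
`ψ ↦ F_c^λ(θ, ψ)` over all (representatives of elements of) `L^∞(ν)`. -/
def kantorovichPotentials {Θ Z X Y : Type*} [MeasurableSpace Z] [MeasurableSpace Y]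
    (c : X × Y → ℝ) (lam : ℝ) (ζ : Measure Z) (ν : Measure Y) (g : Θ → Z → X)
    (θ : Θ) : Set (Y → ℝ) :=
  {ψ | MemLp ψ ⊤ ν ∧
    ∀ φ : Y → ℝ, MemLp φ ⊤ ν → semiDual c lam ζ ν g θ φ ≤ semiDual c lam ζ ν g θ ψ}

end

/-! A potential `u` is optimal at `θ` as soon as the density `exp((u^{c,λ}(g_θ z) - c(g_θ z, y) + u
y)/λ)` has a `ζ`-integral that does not depend on `y`. Its `ν`-integral is always 1, and Jensen's
inequality then compares `u` with every competitor (`mem_kantorovichPotentials_of_integral_exp_eq`).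
This condition says that `u` equals its double soft transform up to an additive constant.

Such a `u` is found for all `θ` simultaneously, as a fixed point among bounded continuous functions
on `Θ × Y`, normalized by subtracting the value at `y₀`. A soft transform shrinks the oscillation of
a difference by the factor `1 - exp(-4M/λ)` with `|c| ≤ M` (`softCTransform_sub_sub_le`). The factor
does not involve `θ`, so Sinkhorn iterates converge uniformly on `Θ × Y`. The limit is jointly
continuous, and currying it gives the selection. -/

open BoundedContinuousFunction

/-! ### Bounds, continuity and contraction for the soft transform. -/

section SoftTransform

/-- A function with oscillation at most `s` takes its values in an interval of length `s`. -/
lemma exists_forall_mem_Icc_of_sub_le {W : Type*} [Nonempty W] {d : W → ℝ} {s : ℝ}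
    (h : ∀ w w', d w - d w' ≤ s) : ∃ a, ∀ w, a ≤ d w ∧ d w ≤ a + s := by
  have hb : BddBelow (Set.range d) := by
    obtain ⟨w₀⟩ := ‹Nonempty W›
    exact ⟨d w₀ - s, by rintro _ ⟨w, rfl⟩; linarith [h w₀ w]⟩
  refine ⟨⨅ w, d w, fun w => ⟨ciInf_le hb w, ?_⟩⟩
  have : d w - s ≤ ⨅ w, d w := le_ciInf fun w' => by linarith [h w w']
  linarith

lemma integrable_exp_of_ae_abs_le {W : Type*} [MeasurableSpace W] {m : Measure W}
    [IsFiniteMeasure m] {f : W → ℝ} {B : ℝ} (hf : AEStronglyMeasurable f m)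
    (hB : ∀ᵐ w ∂m, |f w| ≤ B) : Integrable (fun w => Real.exp (f w)) m := by
  refine Integrable.of_bound (Real.continuous_exp.comp_aestronglyMeasurable hf) (Real.exp B) ?_
  filter_upwards [hB] with w hw
  rw [Real.norm_eq_abs, Real.abs_exp]
  exact Real.exp_le_exp.2 (abs_le.1 hw).2

lemma MeasureTheory.AEStronglyMeasurable.sub_div_const {W : Type*} [MeasurableSpace W]
    {m : Measure W} {f h : W → ℝ} (hf : AEStronglyMeasurable f m)
    (hh : AEStronglyMeasurable h m) (r : ℝ) :
    AEStronglyMeasurable (fun w => (f w - h w) / r) m := by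
  simp only [div_eq_mul_inv]
  exact (hf.sub hh).mul_const r⁻¹

lemma abs_log_integral_exp_le {W : Type*} [MeasurableSpace W] {m : Measure W}
    [IsProbabilityMeasure m] {f : W → ℝ} {B : ℝ} (hf : AEStronglyMeasurable f m)
    (hB : ∀ᵐ w ∂m, |f w| ≤ B) : |Real.log (∫ w, Real.exp (f w) ∂m)| ≤ B := by
  have hi := integrable_exp_of_ae_abs_le hf hB
  have h1 : Real.exp (-B) ≤ ∫ w, Real.exp (f w) ∂m := by
    have := integral_mono_ae (integrable_const (Real.exp (-B))) hi (by
      filter_upwards [hB] with w hw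
      exact Real.exp_le_exp.2 (abs_le.1 hw).1)
    simpa using this
  have h2 : ∫ w, Real.exp (f w) ∂m ≤ Real.exp B := by
    have := integral_mono_ae hi (integrable_const (Real.exp B)) (by
      filter_upwards [hB] with w hw
      exact Real.exp_le_exp.2 (abs_le.1 hw).2)
    simpa using this
  have hpos := (Real.exp_pos _).trans_le h1
  exact abs_le.2 ⟨(Real.le_log_iff_exp_le hpos).2 h1, (Real.log_le_iff_le_exp hpos).2 h2⟩

lemma continuous_log_integral_exp {P W : Type*} [TopologicalSpace P] [FirstCountableTopology P]
    [MeasurableSpace W] {m : Measure W} [IsProbabilityMeasure m] {f : P → W → ℝ} {B : ℝ}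
    (hf : ∀ p, AEStronglyMeasurable (f p) m) (hB : ∀ p, ∀ᵐ w ∂m, |f p w| ≤ B)
    (hc : ∀ᵐ w ∂m, Continuous fun p => f p w) :
    Continuous fun p => Real.log (∫ w, Real.exp (f p w) ∂m) := by
  refine Continuous.log ?_ fun p =>
    (integral_exp_pos (integrable_exp_of_ae_abs_le (hf p) (hB p))).ne'
  refine continuous_of_dominated (bound := fun _ => Real.exp B)
    (fun p => Real.continuous_exp.comp_aestronglyMeasurable (hf p)) (fun p => ?_)
    (integrable_const _) ?_
  · filter_upwards [hB p] with w hw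
    rw [Real.norm_eq_abs, Real.abs_exp]
    exact Real.exp_le_exp.2 (abs_le.1 hw).2
  · filter_upwards [hc] with w hw using Real.continuous_exp.comp hw

lemma abs_sub_div_le {a b K M lam : ℝ} (hlam : 0 < lam) (ha : |a| ≤ K) (hb : |b| ≤ M) :
    |(a - b) / lam| ≤ (K + M) / lam := by
  rw [abs_div, abs_of_pos hlam]
  gcongr
  exact (abs_sub _ _).trans (add_le_add ha hb)

variable {I W : Type*} [MeasurableSpace W] {m : Measure W} [IsProbabilityMeasure m]
  {k : I × W → ℝ} {lam M K : ℝ}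

lemma abs_softCTransform_le (hlam : 0 < lam) {h : W → ℝ} {i : I}
    (hk : AEStronglyMeasurable (fun w => k (i, w)) m) (hM : ∀ p, |k p| ≤ M)
    (hh : AEStronglyMeasurable h m) (hK : ∀ᵐ w ∂m, |h w| ≤ K) :
    |softCTransform k lam m h i| ≤ K + M := by
  have := abs_log_integral_exp_le (m := m) (f := fun w => (h w - k (i, w)) / lam)
    (B := (K + M) / lam) (hh.sub_div_const hk lam)
    (by filter_upwards [hK] with w hw using abs_sub_div_le hlam hw (hM _))
  rw [softCTransform, abs_mul, abs_neg, abs_of_pos hlam]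
  calc _ ≤ lam * ((K + M) / lam) := by gcongr
    _ = K + M := by field_simp

/-- Averages of a function with values in `[exp a, exp (a + t)]` against two probability densities
with comparable weights have logarithms that differ by at most `(1 - ε) * t`. -/
lemma log_sub_log_le_of_le {R S a t ε : ℝ} (hε0 : 0 ≤ ε) (hε1 : ε ≤ 1)
    (hS : Real.exp a ≤ S) (hS' : S ≤ Real.exp (a + t))
    (hR : Real.exp a + ε * (S - Real.exp a) ≤ R) :
    Real.log S - Real.log R ≤ (1 - ε) * t := by
  have hSpos := (Real.exp_pos a).trans_le hS
  have hmix : 0 < Real.exp a + ε * (S - Real.exp a) :=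
    add_pos_of_pos_of_nonneg (Real.exp_pos a) (mul_nonneg hε0 (by linarith))
  -- Concavity gives `log R ≥ (1 - ε) a + ε log S`, and `log S - a ≤ t`.
  have hconc := strictConcaveOn_log_Ioi.concaveOn.2 (Set.mem_Ioi.2 (Real.exp_pos a))
    (Set.mem_Ioi.2 hSpos) (sub_nonneg.2 hε1) hε0 (by ring)
  simp only [smul_eq_mul, Real.log_exp] at hconc
  have h1 := Real.log_le_log hmix hR
  rw [show Real.exp a + ε * (S - Real.exp a) = (1 - ε) * Real.exp a + ε * S by ring] at h1
  have h2 : Real.log S ≤ a + t := (Real.log_le_iff_le_exp hSpos).2 hS'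
  nlinarith [mul_le_mul_of_nonneg_left h2 (sub_nonneg.2 hε1)]

/-- The soft transform contracts the oscillation of differences. -/
lemma softCTransform_sub_sub_le (hlam : 0 < lam) (hk : ∀ i, Measurable fun w => k (i, w))
    (hM : ∀ p, |k p| ≤ M) {h₁ h₂ : W → ℝ} (hm₁ : Measurable h₁) (hm₂ : Measurable h₂)
    (hK₁ : ∀ w, |h₁ w| ≤ K) (hK₂ : ∀ w, |h₂ w| ≤ K) {s : ℝ}
    (hs : ∀ w w', (h₁ w - h₂ w) - (h₁ w' - h₂ w') ≤ s) (i j : I) :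
    (softCTransform k lam m h₁ i - softCTransform k lam m h₂ i) -
      (softCTransform k lam m h₁ j - softCTransform k lam m h₂ j) ≤
      (1 - Real.exp (-(4 * M) / lam)) * s := by
  have : Nonempty W := nonempty_of_isProbabilityMeasure m
  obtain ⟨a, ha⟩ := exists_forall_mem_Icc_of_sub_le hs
  have hM0 : 0 ≤ M := by
    obtain ⟨w⟩ := ‹Nonempty W›
    exact (abs_nonneg _).trans (hM (i, w))
  have hint : ∀ {h : W → ℝ} (_ : Measurable h) (_ : ∀ w, |h w| ≤ K) (i : I),
      Integrable (fun w => Real.exp ((h w - k (i, w)) / lam)) m := fun hh hK i =>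
    integrable_exp_of_ae_abs_le ((hh.sub (hk i)).div_const lam).aestronglyMeasurable
      (ae_of_all _ fun w => abs_sub_div_le hlam (hK w) (hM _))
  -- `δ` bounds below the ratio of the Gibbs weights `exp((h₂ - k)/λ)` at two indices. Normalizing
  -- the weights costs a second `δ`, whence `δ * δ`.
  set δ := Real.exp (-(2 * M) / lam) with hδ
  have hδ0 : 0 < δ := Real.exp_pos _
  have hδε : δ * δ = Real.exp (-(4 * M) / lam) := by
    rw [hδ, ← Real.exp_add]; congr 1; ring
  set A := Real.exp (a / lam) with hA
  have hcmp : ∀ i j w, δ * Real.exp ((h₂ w - k (j, w)) / lam) ≤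
      Real.exp ((h₂ w - k (i, w)) / lam) := fun i j w => by
    rw [hδ, ← Real.exp_add, ← add_div]
    gcongr
    linarith [(abs_le.1 (hM (i, w))).2, (abs_le.1 (hM (j, w))).1]
  have hsplit : ∀ i w, Real.exp ((h₁ w - k (i, w)) / lam) =
      Real.exp ((h₁ w - h₂ w) / lam) * Real.exp ((h₂ w - k (i, w)) / lam) := fun i w => by
    rw [← Real.exp_add]; congr 1; ring
  have hAle : ∀ w, A ≤ Real.exp ((h₁ w - h₂ w) / lam) := fun w => by
    rw [hA]; gcongr; exact (ha w).1
  have hleA : ∀ w, Real.exp ((h₁ w - h₂ w) / lam) ≤ Real.exp (a / lam + s / lam) := fun w => by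
    rw [← add_div]; gcongr; exact (ha w).2
  set I₁ := ∫ w, Real.exp ((h₁ w - k (i, w)) / lam) ∂m with hI₁
  set I₂ := ∫ w, Real.exp ((h₂ w - k (i, w)) / lam) ∂m with hI₂
  set J₁ := ∫ w, Real.exp ((h₁ w - k (j, w)) / lam) ∂m with hJ₁
  set J₂ := ∫ w, Real.exp ((h₂ w - k (j, w)) / lam) ∂m with hJ₂
  have pI₁ : 0 < I₁ := integral_exp_pos (hint hm₁ hK₁ i)
  have pI₂ : 0 < I₂ := integral_exp_pos (hint hm₂ hK₂ i)
  have pJ₁ : 0 < J₁ := integral_exp_pos (hint hm₁ hK₁ j)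
  have pJ₂ : 0 < J₂ := integral_exp_pos (hint hm₂ hK₂ j)
  have e1 : A * J₂ ≤ J₁ := by
    rw [hJ₂, ← integral_const_mul]
    refine integral_mono ((hint hm₂ hK₂ j).const_mul _) (hint hm₁ hK₁ j) fun w => ?_
    simp only [hsplit j w]
    exact mul_le_mul_of_nonneg_right (hAle w) (Real.exp_pos _).le
  have e2 : J₁ ≤ Real.exp (a / lam + s / lam) * J₂ := by
    rw [hJ₂, ← integral_const_mul]
    refine integral_mono (hint hm₁ hK₁ j) ((hint hm₂ hK₂ j).const_mul _) fun w => ?_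
    simp only [hsplit j w]
    exact mul_le_mul_of_nonneg_right (hleA w) (Real.exp_pos _).le
  have e3 : δ * I₂ ≤ J₂ := by
    rw [hI₂, ← integral_const_mul]
    exact integral_mono ((hint hm₂ hK₂ i).const_mul _) (hint hm₂ hK₂ j) fun w => hcmp j i w
  have e4 : δ * (J₁ - A * J₂) ≤ I₁ - A * I₂ := by
    rw [hJ₁, hJ₂, hI₁, hI₂, ← integral_const_mul, ← integral_const_mul,
      ← integral_sub (hint hm₁ hK₁ j) ((hint hm₂ hK₂ j).const_mul _),
      ← integral_sub (hint hm₁ hK₁ i) ((hint hm₂ hK₂ i).const_mul _), ← integral_const_mul]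
    refine integral_mono (((hint hm₁ hK₁ j).sub ((hint hm₂ hK₂ j).const_mul _)).const_mul _)
      ((hint hm₁ hK₁ i).sub ((hint hm₂ hK₂ i).const_mul _)) fun w => ?_
    simp only [hsplit i w, hsplit j w]
    have := mul_le_mul_of_nonneg_left (hcmp i j w) (sub_nonneg.2 (hAle w))
    linarith
  -- `I₁ / I₂` and `J₁ / J₂` are the means of `exp((h₁ - h₂)/λ)` under the normalized weights at `i`
  -- and `j`.
  have key := log_sub_log_le_of_le (R := I₁ / I₂) (S := J₁ / J₂) (a := a / lam) (t := s / lam)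
    (ε := Real.exp (-(4 * M) / lam)) (Real.exp_pos _).le
    (Real.exp_le_one_iff.2 (div_nonpos_of_nonpos_of_nonneg (by linarith) hlam.le))
    ((le_div_iff₀ pJ₂).2 e1) ((div_le_iff₀ pJ₂).2 e2) (by
      rw [le_div_iff₀ pI₂, ← hδε, ← hA]
      have hnn : 0 ≤ J₁ / J₂ - A := sub_nonneg.2 ((le_div_iff₀ pJ₂).2 e1)
      have e5 := mul_le_mul_of_nonneg_left e3 (mul_nonneg hδ0.le hnn)
      have e6 : δ * (J₁ / J₂ - A) * J₂ = δ * (J₁ - A * J₂) := by field_simp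
      linarith)
  rw [Real.log_div pJ₁.ne' pJ₂.ne', Real.log_div pI₁.ne' pI₂.ne'] at key
  simp only [softCTransform, ← hI₁, ← hI₂, ← hJ₁, ← hJ₂]
  have := mul_le_mul_of_nonneg_left key hlam.le
  have e7 : lam * ((1 - Real.exp (-(4 * M) / lam)) * (s / lam)) =
    (1 - Real.exp (-(4 * M) / lam)) * s := by field_simp
  linarith

end SoftTransform

/-! ### A sufficient condition for optimality. -/

section Optimality

/-- Jensen's inequality for the exponential and the probability density `ρ`. -/
lemma integral_mul_le_log_integral_exp_mul {W : Type*} [MeasurableSpace W] {m : Measure W}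
    {ρ d : W → ℝ} (hρ : ∀ w, 0 ≤ ρ w) (hρi : Integrable ρ m) (hρ1 : ∫ w, ρ w ∂m = 1)
    (hdi : Integrable (fun w => d w * ρ w) m)
    (hei : Integrable (fun w => Real.exp (d w) * ρ w) m) :
    ∫ w, d w * ρ w ∂m ≤ Real.log (∫ w, Real.exp (d w) * ρ w ∂m) := by
  set t := ∫ w, d w * ρ w ∂m with ht
  -- Integrate against `ρ` the tangent line inequality for `exp` at the mean `t`.
  have hlow : Real.exp t ≤ ∫ w, Real.exp (d w) * ρ w ∂m := by
    calc Real.exp t = ∫ w, Real.exp t * (ρ w + (d w * ρ w - t * ρ w)) ∂m := by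
          have hsub : Integrable (fun w => d w * ρ w - t * ρ w) m := hdi.sub (hρi.const_mul t)
          rw [integral_const_mul, integral_add hρi hsub, integral_sub hdi (hρi.const_mul t),
            integral_const_mul, hρ1, ← ht]
          ring
      _ ≤ _ := by
          refine integral_mono ((hρi.add (hdi.sub (hρi.const_mul t))).const_mul _) hei fun w => ?_
          have h1 : Real.exp (d w) = Real.exp t * Real.exp (d w - t) := by
            rw [← Real.exp_add]; congr 1; ring
          have h2 := Real.add_one_le_exp (d w - t)
          have h3 := mul_le_mul_of_nonneg_right h2 (hρ w)
          have h4 := mul_le_mul_of_nonneg_left h3 (Real.exp_pos t).le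
          simp only [h1]
          linarith
  exact (Real.le_log_iff_exp_le ((Real.exp_pos t).trans_le hlow)).2 hlow

lemma MeasureTheory.MemLp.exists_ae_abs_le {W : Type*} [MeasurableSpace W] {m : Measure W}
    {φ : W → ℝ} (h : MemLp φ ⊤ m) : ∃ B, ∀ᵐ w ∂m, |φ w| ≤ B := by
  refine ⟨(eLpNormEssSup φ m).toReal, ?_⟩
  have hlt : eLpNormEssSup φ m ≠ ⊤ := by
    have := h.2
    rw [eLpNorm_exponent_top] at this
    exact this.ne
  filter_upwards [enorm_ae_le_eLpNormEssSup φ m] with w hw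
  rw [← Real.norm_eq_abs, ← toReal_enorm]
  exact ENNReal.toReal_mono hlt hw

variable {X Y : Type*} [MetricSpace X] [MetricSpace Y]
  [MeasurableSpace Y] [BorelSpace Y] {ν : Measure Y} [IsProbabilityMeasure ν] {c : X × Y → ℝ}
  {lam M : ℝ}

lemma continuous_softCTransform (hc : Continuous c) (hlam : 0 < lam) (hM : ∀ p, |c p| ≤ M)
    {φ : Y → ℝ} (hφ : MemLp φ ⊤ ν) : Continuous (softCTransform c lam ν φ) := by
  obtain ⟨B, hB⟩ := hφ.exists_ae_abs_le
  refine continuous_const.mul (continuous_log_integral_exp (B := (B + M) / lam) (fun x => ?_)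
    (fun x => ?_) (ae_of_all _ fun y => by fun_prop))
  · exact hφ.1.sub_div_const
      (Continuous.aestronglyMeasurable (by fun_prop : Continuous fun y => c (x, y))) lam
  · filter_upwards [hB] with y hy using abs_sub_div_le hlam hy (hM _)

variable [CompactSpace X] [CompactSpace Y] [MeasurableSpace X] [BorelSpace X]
  {Θ Z : Type*} [MeasurableSpace Z] {ζ : Measure Z} [IsProbabilityMeasure ζ] {g : Θ → Z → X}

/-- A bounded potential whose Gibbs density has a constant second marginal is optimal. -/
lemma mem_kantorovichPotentials_of_integral_exp_eq (hc : Continuous c) (hlam : 0 < lam)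
    {θ : Θ} (hg : Measurable (g θ)) (u : C(Y, ℝ)) {κ : ℝ}
    (hκ : ∀ y, ∫ z, Real.exp
      ((softCTransform c lam ν u (g θ z) - c (g θ z, y) + u y) / lam) ∂ζ = κ) :
    ⇑u ∈ kantorovichPotentials c lam ζ ν g θ := by
  have : Nonempty Z := nonempty_of_isProbabilityMeasure ζ
  obtain ⟨M, hM⟩ : ∃ M, ∀ p, |c p| ≤ M :=
    ⟨‖(⟨c, hc⟩ : C(X × Y, ℝ))‖, (⟨c, hc⟩ : C(X × Y, ℝ)).norm_coe_le_norm⟩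
  have hu : MemLp u ⊤ ν := memLp_top_of_bound u.continuous.aestronglyMeasurable ‖u‖
    (ae_of_all _ u.norm_coe_le_norm)
  have hKu : ∀ y, |u y| ≤ ‖u‖ := u.norm_coe_le_norm
  refine ⟨hu, fun φ hφ => ?_⟩
  obtain ⟨B, hB⟩ := hφ.exists_ae_abs_le
  have hck : ∀ x, AEStronglyMeasurable (fun y => c (x, y)) ν := fun x =>
    Continuous.aestronglyMeasurable (by fun_prop)
  have hsc : ∀ {η : Y → ℝ} (_ : MemLp η ⊤ ν),
      Integrable (fun z => softCTransform c lam ν η (g θ z)) ζ := fun {η} hη => by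
    obtain ⟨D, hD⟩ := hη.exists_ae_abs_le
    exact Integrable.of_bound ((continuous_softCTransform hc hlam hM hη).measurable.comp
      hg).aestronglyMeasurable (D + M)
      (ae_of_all _ fun z => abs_softCTransform_le hlam (hck _) hM hη.1 hD)
  have hui : Integrable u ν := hu.integrable le_top
  have hφi : Integrable φ ν := hφ.integrable le_top
  set ρ : Z → Y → ℝ := fun z y =>
    Real.exp ((softCTransform c lam ν u (g θ z) - c (g θ z, y) + u y) / lam) with hρ
  have hρm : Measurable (Function.uncurry ρ) := by
    have h1 := (continuous_softCTransform hc hlam hM hu).measurable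
    have h2 := hc.measurable
    have h3 := u.continuous.measurable
    simp only [hρ, Function.uncurry_def]
    fun_prop
  have hρb : ∀ z y, ‖ρ z y‖ ≤ Real.exp ((‖u‖ + M + M + ‖u‖) / lam) := fun z y => by
    rw [Real.norm_eq_abs, Real.abs_exp]
    gcongr
    · linarith [(abs_le.1 (abs_softCTransform_le hlam (hck (g θ z)) hM hu.1 (ae_of_all _ hKu))).2,
        (abs_le.1 (hM (g θ z, y))).1]
    · exact (abs_le.1 (hKu y)).2
  have hρi : ∀ z, Integrable (ρ z) ν := fun z =>
    Integrable.of_bound (hρm.comp measurable_prodMk_left).aestronglyMeasurable _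
      (ae_of_all _ (hρb z))
  have hgibbs : ∀ (η : Y → ℝ) z, ∫ y, Real.exp ((η y - u y) / lam) * ρ z y ∂ν =
      Real.exp (softCTransform c lam ν u (g θ z) / lam) *
        ∫ y, Real.exp ((η y - c (g θ z, y)) / lam) ∂ν := fun η z => by
    rw [← integral_const_mul]
    congr 1 with y
    rw [hρ, ← Real.exp_add, ← Real.exp_add]
    congr 1
    ring
  have hZpos : ∀ {η : Y → ℝ} (_ : MemLp η ⊤ ν) z,
      0 < ∫ y, Real.exp ((η y - c (g θ z, y)) / lam) ∂ν := fun {η} hη z => by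
    obtain ⟨D, hD⟩ := hη.exists_ae_abs_le
    refine integral_exp_pos (integrable_exp_of_ae_abs_le (B := (D + M) / lam) ?_ ?_)
    · exact hη.1.sub_div_const (hck _) lam
    · filter_upwards [hD] with y hy using abs_sub_div_le hlam hy (hM _)
  have hlog : ∀ {η : Y → ℝ} (_ : MemLp η ⊤ ν) z,
      lam * Real.log (∫ y, Real.exp ((η y - u y) / lam) * ρ z y ∂ν) =
      softCTransform c lam ν u (g θ z) - softCTransform c lam ν η (g θ z) := fun {η} hη z => by
    rw [hgibbs, Real.log_mul (Real.exp_pos _).ne' (hZpos hη z).ne', Real.log_exp]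
    simp only [softCTransform]
    field_simp
    ring
  have hρ1 : ∀ z, ∫ y, ρ z y ∂ν = 1 := fun z => by
    have h1 := hgibbs u z
    simp only [sub_self, zero_div, Real.exp_zero, one_mul] at h1
    rw [h1, ← Real.exp_log (hZpos hu z), ← Real.exp_add, softCTransform]
    rw [Real.exp_eq_one_iff]
    field_simp
    ring
  have hdm : AEStronglyMeasurable (fun y => (φ y - u y) / lam) ν :=
    hφ.1.sub_div_const hu.1 lam
  have hdi : Integrable (fun y => (φ y - u y) / lam) ν := (hφi.sub hui).div_const lam
  have hprod : Integrable (Function.uncurry fun z y => (φ y - u y) / lam * ρ z y) (ζ.prod ν) :=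
    (hdi.comp_snd ζ).mul_bdd hρm.aestronglyMeasurable (ae_of_all _ fun p => hρb p.1 p.2)
  -- Supergradient inequality: the soft transform is concave in the potential, and `ρ z` is minus
  -- its derivative at `u`.
  have hjen : ∀ z, softCTransform c lam ν φ (g θ z) ≤ softCTransform c lam ν u (g θ z) -
      lam * ∫ y, (φ y - u y) / lam * ρ z y ∂ν := fun z => by
    have := integral_mul_le_log_integral_exp_mul (fun y => (Real.exp_pos _).le) (hρi z) (hρ1 z)
      (hdi.mul_bdd (hρi z).1 (ae_of_all _ (hρb z)))
      (Integrable.mul_bdd (integrable_exp_of_ae_abs_le hdm (B := (B + ‖u‖) / lam) (by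
        filter_upwards [hB] with y hy using abs_sub_div_le hlam hy (hKu y))) (hρi z).1
        (ae_of_all _ (hρb z)))
    have := mul_le_mul_of_nonneg_left this hlam.le
    rw [hlog hφ z] at this
    linarith
  -- Both orders of integration give the total mass of `ρ`.
  have hκ1 : κ = 1 := by
    have hρprod : Integrable (Function.uncurry ρ) (ζ.prod ν) :=
      Integrable.of_bound hρm.aestronglyMeasurable _ (ae_of_all _ fun p => hρb p.1 p.2)
    have := integral_integral_swap hρprod
    simp only [hρ1] at this
    simpa [hρ, hκ] using this.symm
  -- The first-order term reduces to a `ν`-integral, which cancels the change in `E_ν[ψ]`.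
  have hswap : ∫ z, ∫ y, (φ y - u y) / lam * ρ z y ∂ν ∂ζ = ∫ y, (φ y - u y) / lam ∂ν := by
    rw [integral_integral_swap hprod]
    congr 1 with y
    rw [integral_const_mul, hκ y, hκ1, mul_one]
  have hint := integral_mono (hsc hφ) ((hsc hu).sub (hprod.integral_prod_left.const_mul lam)) hjen
  have hswap' : lam * ∫ y, (φ y - u y) / lam ∂ν = ∫ y, φ y ∂ν - ∫ y, u y ∂ν := by
    rw [integral_div, integral_sub hφi hui]
    field_simp
  have hfin := integral_sub (hsc hu) (hprod.integral_prod_left.const_mul lam)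
  simp only [Function.uncurry_apply_pair, integral_const_mul] at hfin hint
  rw [hswap, hswap'] at hfin
  simp only [Pi.sub_apply] at hint
  simp only [semiDual]
  linarith

end Optimality

/-! ### The Sinkhorn iteration with parameter, and its fixed point. -/

section Sinkhorn

lemma measurable_cost_comp {Θ Z X Y : Type*} [MeasurableSpace Z] [TopologicalSpace X]
    [MeasurableSpace X] [BorelSpace X] [TopologicalSpace Y] {c : X × Y → ℝ} {g : Θ → Z → X}
    (hc : Continuous c) (hg_meas : ∀ θ, Measurable (g θ))
    (θ : Θ) (y : Y) :
    Measurable fun z => c (g θ z, y) :=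
  (hc.comp (Continuous.prodMk_left y)).measurable.comp (hg_meas θ)

variable {Θ Z X Y : Type*} [MeasurableSpace Z] [MeasurableSpace Y]

/-- One step of the Sinkhorn iteration, at each parameter: the soft transform of the soft
transform. -/
noncomputable def sinkhornStep (c : X × Y → ℝ) (lam : ℝ) (ζ : Measure Z) (ν : Measure Y)
    (g : Θ → Z → X) (u : Θ × Y → ℝ) (p : Θ × Y) : ℝ :=
  softCTransform (fun q : Y × Z => c (g p.1 q.2, q.1)) lam ζ
    (fun z => softCTransform c lam ν (fun y => u (p.1, y)) (g p.1 z)) p.2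

variable [MetricSpace Θ] [MetricSpace X]
  [MetricSpace Y] [BorelSpace Y] {ζ : Measure Z} [IsProbabilityMeasure ζ]
  {ν : Measure Y} [IsProbabilityMeasure ν] {c : X × Y → ℝ} {lam M K : ℝ} {g : Θ → Z → X}

lemma continuous_softCTransform_uncurry [SecondCountableTopology Y] (hc : Continuous c)
    (hlam : 0 < lam) (hM : ∀ p, |c p| ≤ M) {u : Θ × Y → ℝ} (hu : Continuous u)
    (hK : ∀ p, |u p| ≤ K) :
    Continuous fun q : Θ × X => softCTransform c lam ν (fun y => u (q.1, y)) q.2 :=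
  continuous_const.mul (continuous_log_integral_exp (B := (K + M) / lam)
    (fun q => Continuous.aestronglyMeasurable (by fun_prop))
    (fun q => ae_of_all _ fun y => abs_sub_div_le hlam (hK _) (hM _))
    (ae_of_all _ fun y => by fun_prop))

lemma abs_softCTransform_uncurry_le (hc : Continuous c) (hlam : 0 < lam) (hM : ∀ p, |c p| ≤ M)
    {u : Θ × Y → ℝ} (hu : Continuous u) (hK : ∀ p, |u p| ≤ K) (θ : Θ) (x : X) :
    |softCTransform c lam ν (fun y => u (θ, y)) x| ≤ K + M :=
  abs_softCTransform_le hlam (Continuous.aestronglyMeasurable (by fun_prop)) hM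
    (Continuous.aestronglyMeasurable (by fun_prop)) (ae_of_all _ fun _ => hK _)

variable [SecondCountableTopology Y] [MeasurableSpace X] [BorelSpace X]

lemma measurable_softCTransform_uncurry_comp (hc : Continuous c) (hlam : 0 < lam)
    (hM : ∀ p, |c p| ≤ M) (hg_meas : ∀ θ, Measurable (g θ))
    {u : Θ × Y → ℝ} (hu : Continuous u) (hK : ∀ p, |u p| ≤ K) (θ : Θ) :
    Measurable fun z => softCTransform c lam ν (fun y => u (θ, y)) (g θ z) := by
  have h1 : Continuous fun x => softCTransform c lam ν (fun y => u (θ, y)) x :=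
    (continuous_softCTransform_uncurry hc hlam hM hu hK).comp (Continuous.prodMk_right θ)
  exact h1.measurable.comp (hg_meas θ)

lemma abs_sinkhornStep_le (hc : Continuous c) (hlam : 0 < lam) (hM : ∀ p, |c p| ≤ M)
    (hg_meas : ∀ θ, Measurable (g θ)) {u : Θ × Y → ℝ} (hu : Continuous u)
    (hK : ∀ p, |u p| ≤ K) (p : Θ × Y) : |sinkhornStep c lam ζ ν g u p| ≤ K + M + M :=
  abs_softCTransform_le hlam (measurable_cost_comp hc hg_meas _ _).aestronglyMeasurable
    (fun _ => hM _)
    (measurable_softCTransform_uncurry_comp hc hlam hM hg_meas hu hK _).aestronglyMeasurable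
    (ae_of_all _ fun _ => abs_softCTransform_uncurry_le hc hlam hM hu hK _ _)

/-- Pointwise continuity of `θ ↦ g θ z` suffices: the integrands are uniformly bounded, so dominated
convergence applies. -/
lemma continuous_sinkhornStep (hc : Continuous c) (hlam : 0 < lam) (hM : ∀ p, |c p| ≤ M)
    (hg_meas : ∀ θ, Measurable (g θ)) (hg_cont : ∀ z, Continuous fun θ => g θ z)
    {u : Θ × Y → ℝ} (hu : Continuous u) (hK : ∀ p, |u p| ≤ K) :
    Continuous (sinkhornStep c lam ζ ν g u) := by
  refine continuous_const.mul (continuous_log_integral_exp (B := (K + M + M) / lam)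
    (fun q => AEStronglyMeasurable.sub_div_const ?_ ?_ lam)
    (fun q => ae_of_all _ fun z => abs_sub_div_le hlam
      (abs_softCTransform_uncurry_le hc hlam hM hu hK _ _) (hM _))
    (ae_of_all _ fun z => ?_))
  · exact (measurable_softCTransform_uncurry_comp hc hlam hM hg_meas hu hK _).aestronglyMeasurable
  · exact (measurable_cost_comp hc hg_meas _ _).aestronglyMeasurable
  · have h1 := hg_cont z
    have h2 : Continuous fun p : Θ × Y =>
        softCTransform c lam ν (fun y => u (p.1, y)) (g p.1 z) :=
      (continuous_softCTransform_uncurry hc hlam hM hu hK).comp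
        (by fun_prop : Continuous fun p : Θ × Y => (p.1, g p.1 z))
    have h3 : Continuous fun p : Θ × Y => c (g p.1 z, p.2) := by fun_prop
    exact (h2.sub h3).div_const lam

/-- Each of the two soft transforms, against `ν` and then `ζ`, contributes one contraction factor.
-/
lemma sinkhornStep_sub_sub_le (hc : Continuous c) (hlam : 0 < lam) (hM : ∀ p, |c p| ≤ M)
    (hg_meas : ∀ θ, Measurable (g θ)) {u v : Θ × Y → ℝ} (hu : Continuous u) (hv : Continuous v)
    (hKu : ∀ p, |u p| ≤ K) (hKv : ∀ p, |v p| ≤ K) {s : ℝ}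
    (hs : ∀ θ y y', (u (θ, y) - v (θ, y)) - (u (θ, y') - v (θ, y')) ≤ s) (θ : Θ) (y y' : Y) :
    (sinkhornStep c lam ζ ν g u (θ, y) - sinkhornStep c lam ζ ν g v (θ, y)) -
      (sinkhornStep c lam ζ ν g u (θ, y') - sinkhornStep c lam ζ ν g v (θ, y')) ≤
      (1 - Real.exp (-(4 * M) / lam)) * ((1 - Real.exp (-(4 * M) / lam)) * s) :=
  softCTransform_sub_sub_le hlam (fun y => measurable_cost_comp hc hg_meas _ y) (fun _ => hM _)
    (measurable_softCTransform_uncurry_comp hc hlam hM hg_meas hu hKu θ)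
    (measurable_softCTransform_uncurry_comp hc hlam hM hg_meas hv hKv θ)
    (fun _ => abs_softCTransform_uncurry_le hc hlam hM hu hKu _ _)
    (fun _ => abs_softCTransform_uncurry_le hc hlam hM hv hKv _ _)
    (fun _ _ => softCTransform_sub_sub_le hlam
      (fun x => (hc.comp (Continuous.prodMk_right x)).measurable) hM
      (hu.comp (Continuous.prodMk_right θ)).measurable
      (hv.comp (Continuous.prodMk_right θ)).measurable (fun _ => hKu _) (fun _ => hKv _)
      (hs θ) _ _) y y'

/-- The Sinkhorn iteration, normalized at `y₀`, has a continuous bounded fixed point. -/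
lemma exists_sinkhornStep_fixedPoint (hc : Continuous c) (hlam : 0 < lam)
    (hM0 : 0 ≤ M) (hM : ∀ p, |c p| ≤ M)
    (hg_meas : ∀ θ, Measurable (g θ)) (hg_cont : ∀ z, Continuous fun θ => g θ z) (y₀ : Y) :
    ∃ u : Θ × Y →ᵇ ℝ, ∀ θ y, u (θ, y) =
      sinkhornStep c lam ζ ν g u (θ, y) - sinkhornStep c lam ζ ν g u (θ, y₀) := by
  let T : (Θ × Y →ᵇ ℝ) → (Θ × Y →ᵇ ℝ) := fun u =>
    BoundedContinuousFunction.ofNormedAddCommGroup (fun p =>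
      sinkhornStep c lam ζ ν g u p - sinkhornStep c lam ζ ν g u (p.1, y₀))
      (by
        have := continuous_sinkhornStep (ζ := ζ) (ν := ν) hc hlam hM hg_meas hg_cont
          u.continuous u.norm_coe_le_norm
        fun_prop)
      ((‖u‖ + M + M) + (‖u‖ + M + M)) (fun p => (abs_sub _ _).trans (add_le_add
        (abs_sinkhornStep_le hc hlam hM hg_meas u.continuous u.norm_coe_le_norm _)
        (abs_sinkhornStep_le hc hlam hM hg_meas u.continuous u.norm_coe_le_norm _)))
  have hT : ∀ u p, T u p =
      sinkhornStep c lam ζ ν g u p - sinkhornStep c lam ζ ν g u (p.1, y₀) := fun _ _ => rfl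
  set r := 1 - Real.exp (-(4 * M) / lam) with hr
  have hr0 : 0 ≤ r := sub_nonneg.2
    (Real.exp_le_one_iff.2 (div_nonpos_of_nonpos_of_nonneg (by linarith) hlam.le))
  have hr1 : r < 1 := by linarith [Real.exp_pos (-(4 * M) / lam)]
  have hrr0 : 0 ≤ r * r := mul_nonneg hr0 hr0
  have hrr1 : r * r < 1 := by nlinarith
  have hosc : ∀ (u v : Θ × Y →ᵇ ℝ) (s : ℝ),
      (∀ θ y y', (u (θ, y) - v (θ, y)) - (u (θ, y') - v (θ, y')) ≤ s) →
      ∀ θ y y', (T u (θ, y) - T v (θ, y)) - (T u (θ, y') - T v (θ, y')) ≤ r * r * s := by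
    intro u v s hs θ y y'
    have := sinkhornStep_sub_sub_le (ζ := ζ) (ν := ν) (K := max ‖u‖ ‖v‖) hc hlam hM hg_meas
      u.continuous v.continuous (fun p => (u.norm_coe_le_norm p).trans (le_max_left _ _))
      (fun p => (v.norm_coe_le_norm p).trans (le_max_right _ _)) hs θ y y'
    simp only [hT]
    rw [← hr] at this
    linarith
  -- Oscillation ignores constants; agreement at `y₀` turns it into control of the uniform distance.
  have hdist : ∀ (u v : Θ × Y →ᵇ ℝ) (s : ℝ), 0 ≤ s → (∀ θ, u (θ, y₀) = v (θ, y₀)) →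
      (∀ θ y y', (u (θ, y) - v (θ, y)) - (u (θ, y') - v (θ, y')) ≤ s) → dist u v ≤ s := by
    intro u v s hs h0 h
    refine (BoundedContinuousFunction.dist_le hs).2 fun ⟨θ, y⟩ => ?_
    rw [Real.dist_eq]
    have h1 := h θ y y₀
    have h2 := h θ y₀ y
    rw [h0 θ] at h1 h2
    exact abs_le.2 ⟨by linarith, by linarith⟩
  have hdist' : ∀ (u v : Θ × Y →ᵇ ℝ) θ y y',
      (u (θ, y) - v (θ, y)) - (u (θ, y') - v (θ, y')) ≤ 2 * dist u v := by
    intro u v θ y y'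
    have h1 := abs_le.1 (u.dist_coe_le_dist (g := v) (θ, y))
    have h2 := abs_le.1 (u.dist_coe_le_dist (g := v) (θ, y'))
    linarith [h1.2, h2.1]
  have hT0 : ∀ u θ, T u (θ, y₀) = 0 := fun u θ => sub_self _
  -- `T` need not contract the uniform distance. This bound only provides the continuity that makes
  -- the limit a fixed point; the geometric decay is that of oscillations.
  have hTlip : LipschitzWith 2 T := LipschitzWith.of_dist_le_mul fun u v => by
    refine hdist _ _ _ (by positivity) (fun θ => by rw [hT0, hT0]) fun θ y y' =>
      (hosc u v _ (hdist' u v) θ y y').trans ?_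
    have : 0 ≤ dist u v := dist_nonneg
    simp only [NNReal.coe_ofNat]
    nlinarith
  let U : ℕ → (Θ × Y →ᵇ ℝ) := fun n => T^[n] 0
  have hU : ∀ n, U (n + 1) = T (U n) := fun n => Function.iterate_succ_apply' T n 0
  have hU0 : ∀ n θ, U n (θ, y₀) = 0 := by
    rintro (_ | n) θ
    · rfl
    · rw [hU, hT0]
  have hstep : ∀ n θ y y', (U n (θ, y) - U (n + 1) (θ, y)) -
      (U n (θ, y') - U (n + 1) (θ, y')) ≤ 2 * dist (U 0) (U 1) * (r * r) ^ n := by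
    intro n
    induction n with
    | zero => simpa using hdist' (U 0) (U 1)
    | succ n ih =>
      intro θ y y'
      rw [hU (n + 1), hU n, pow_succ]
      have := hosc (U n) (U (n + 1)) _ ih θ y y'
      rw [hU n] at this
      linarith
  have hcauchy : CauchySeq U := cauchySeq_of_le_geometric (r * r) (2 * dist (U 0) (U 1)) hrr1
    fun n => hdist _ _ _ (by positivity) (fun θ => by rw [hU0, hU0]) (hstep n)
  obtain ⟨u, hu⟩ := cauchySeq_tendsto_of_complete hcauchy
  have hfix : T u = u := isFixedPt_of_tendsto_iterate hu hTlip.continuous.continuousAt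
  exact ⟨u, fun θ y => by rw [← hT u (θ, y), hfix]⟩

end Sinkhorn

theorem lemma2 {Θ Z X Y : Type*} [MetricSpace Θ] [MeasurableSpace Z]
    [MetricSpace X] [CompactSpace X] [MeasurableSpace X] [BorelSpace X]
    [MetricSpace Y] [CompactSpace Y] [MeasurableSpace Y] [BorelSpace Y]
    (ζ : Measure Z) [IsProbabilityMeasure ζ] (ν : Measure Y) [IsProbabilityMeasure ν]
    (c : X × Y → ℝ) (hc : Continuous c) (lam : ℝ) (hlam : 0 < lam)
    (g : Θ → Z → X) (hg_meas : ∀ θ, Measurable (g θ))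
    (hg_cont : ∀ z, Continuous fun θ => g θ z) (y₀ : Y) :
    ∃ ψ : Θ → C(Y, ℝ), Continuous ψ ∧
      ∀ θ, ⇑(ψ θ) ∈ kantorovichPotentials c lam ζ ν g θ ∧ ψ θ y₀ = 0 := by
  obtain ⟨M, hM0, hM⟩ : ∃ M, 0 ≤ M ∧ ∀ p, |c p| ≤ M :=
    ⟨‖(⟨c, hc⟩ : C(X × Y, ℝ))‖, norm_nonneg _, (⟨c, hc⟩ : C(X × Y, ℝ)).norm_coe_le_norm⟩
  obtain ⟨u, hu⟩ := exists_sinkhornStep_fixedPoint (ζ := ζ) (ν := ν) hc hlam hM0 hM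
    hg_meas hg_cont y₀
  -- As `Y` is compact, the compact-open topology on `C(Y, ℝ)` is that of the uniform norm.
  refine ⟨u.toContinuousMap.curry, u.toContinuousMap.curry.continuous, fun θ => ⟨?_, ?_⟩⟩
  · refine mem_kantorovichPotentials_of_integral_exp_eq hc hlam (hg_meas θ) _
      -- By the fixed-point equation, `u` and the Sinkhorn step differ by the step's value at `y₀`,
      -- which is free of `y`.
      (κ := Real.exp (-sinkhornStep c lam ζ ν g u (θ, y₀) / lam)) fun y => ?_
    set φ : Z → ℝ := fun z => softCTransform c lam ν (fun y => u (θ, y)) (g θ z) with hφ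
    have hint : Integrable (fun z => Real.exp ((φ z - c (g θ z, y)) / lam)) ζ :=
      integrable_exp_of_ae_abs_le (B := (‖u‖ + M + M) / lam)
        ((measurable_softCTransform_uncurry_comp hc hlam hM hg_meas u.continuous
          u.norm_coe_le_norm θ).aestronglyMeasurable.sub_div_const
          (measurable_cost_comp hc hg_meas θ y).aestronglyMeasurable lam)
        (ae_of_all _ fun z => abs_sub_div_le hlam
          (abs_softCTransform_uncurry_le hc hlam hM u.continuous u.norm_coe_le_norm _ _) (hM _))
    have hS : ∫ z, Real.exp ((φ z - c (g θ z, y)) / lam) ∂ζ =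
        Real.exp (-sinkhornStep c lam ζ ν g u (θ, y) / lam) := by
      rw [← Real.exp_log (integral_exp_pos hint), sinkhornStep, softCTransform]
      congr 1
      field_simp
      rfl
    calc ∫ z, Real.exp ((φ z - c (g θ z, y) + u (θ, y)) / lam) ∂ζ
        = ∫ z, Real.exp ((φ z - c (g θ z, y)) / lam) * Real.exp (u (θ, y) / lam) ∂ζ := by
          congr 1 with z
          rw [← Real.exp_add, ← add_div]
      _ = Real.exp (-sinkhornStep c lam ζ ν g u (θ, y₀) / lam) := by
          rw [integral_mul_const, hS, ← Real.exp_add, hu θ y]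
          congr 1
          ring
  · exact (hu θ y₀).trans (sub_self _)
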